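/- A poset $(P,\le_P)$ with $P\subseteq\omega$ is a set $P$ of natural numbers with a reflexive, antisymmetric and transitive relation $\le_P\,\subseteq P\times P$; it is coded by the set $P\oplus\{\langle x,y\rangle : x\le_P y\}\subseteq\omega$, where $A\oplus B=\{2n:n\in A\}\cup\{2n+1:n\in B\}$ and $\langle\cdot,\cdot\rangle$ is a standard computable pairing function, and it is identified with its code. It is $\omega$-ordered if $x\le_P y$ implies $x\le y$ for all $x,y\in P$. Let $\mathsf{CAC}$ be the problem whose instances are the infinite posets $(P,\le_P)$ with $P\subseteq\omega$, and whose solutions to $(P,\le_P)$ are the infinite sets $Y\subseteq P$ that are chains (any two elements are $\le_P$-comparable) or antichains (any two distinct elements are $\le_P$-incomparable). Let $\omega\text{-}\mathsf{CAC}$ be the restriction of $\mathsf{CAC}$ to $\omega$-ordered instances. A problem $\mathsf P$ is computably reducible to a problem $\mathsf Q$, written $\mathsf P\le_{\mathrm c}\mathsf Q$, if for every instance $X$ of $\mathsf P$ there is an instance $Z\le_{\mathrm T}X$ of $\mathsf Q$ such that for every solution $Y$ of $Z$ there is a solution $W$ of $X$ with $W\le_{\mathrm T}X\oplus Y$. **Theorem.**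 $\mathsf{CAC}$ is not computably reducible to $\omega\text{-}\mathsf{CAC}$, that is, $\mathsf{CAC}\not\le_{\mathrm c}\omega\text{-}\mathsf{CAC}$. -/

import Mathlib

open scoped Classical in
/-- The characteristic function of a set of natural numbers, as a (total) partial function. -/
noncomputable def charFun (A : Set ℕ) : ℕ →. ℕ :=
  fun n => Part.some (if n ∈ A then 1 else 0)

/-- Turing reducibility `A ≤_T B` between sets of natural numbers. -/
def SetTuringReducible (A B : Set ℕ) : Prop :=
  TuringReducible (charFun A) (charFun B)

/-- The effective join `A ⊕ B = {2n : n ∈ A} ∪ {2n + 1 : n ∈ B}`. -/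
def effectiveJoin (A B : Set ℕ) : Set ℕ :=
  {k | (∃ n ∈ A, k = 2 * n) ∨ (∃ n ∈ B, k = 2 * n + 1)}

/-- An instance-solution problem on sets of natural numbers. `IsSolution X Y` is only of interest
when `X` is an instance. -/
structure InstanceSolutionProblem where
  IsInstance : Set ℕ → Prop
  IsSolution : Set ℕ → Set ℕ → Prop

namespace InstanceSolutionProblem

/-- The problem with the same solutions and only those instances that satisfy `φ`. -/
def restrict (Q : InstanceSolutionProblem) (φ : Set ℕ → Prop) : InstanceSolutionProblem where
  IsInstance X := Q.IsInstance X ∧ φ X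
  IsSolution := Q.IsSolution

/-- Computable reducibility `P ≤_c Q`. -/
def ComputablyReducible (P Q : InstanceSolutionProblem) : Prop :=
  ∀ X, P.IsInstance X →
    ∃ Z, Q.IsInstance Z ∧ SetTuringReducible Z X ∧
      ∀ Y, Q.IsSolution Z Y →
        ∃ W, P.IsSolution X W ∧ SetTuringReducible W (effectiveJoin X Y)

end InstanceSolutionProblem

/-- The code `P ⊕ {⟨x, y⟩ : x ≤_P y}` of a set `P` with a binary relation. -/
def relCode (P : Set ℕ) (r : ℕ → ℕ → Prop) : Set ℕ :=
  effectiveJoin P {k | r k.unpair.1 k.unpair.2}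

/-- The underlying set `P` of the pair `(P, ≤_P)` that is coded by `X`. -/
def codedCarrier (X : Set ℕ) : Set ℕ := {n | 2 * n ∈ X}

/-- The relation `≤_P` of the pair `(P, ≤_P)` that is coded by `X`. -/
def codedRel (X : Set ℕ) (x y : ℕ) : Prop := 2 * Nat.pair x y + 1 ∈ X

theorem codedCarrier_relCode (P : Set ℕ) (r : ℕ → ℕ → Prop) :
    codedCarrier (relCode P r) = P := by
  ext n
  constructor
  · rintro (⟨m, hm, h⟩ | ⟨m, -, h⟩)
    · have : n = m := by omega
      exact this ▸ hm
    · omega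
  · exact fun h => Or.inl ⟨n, h, rfl⟩

theorem codedRel_relCode (P : Set ℕ) (r : ℕ → ℕ → Prop) :
    codedRel (relCode P r) = r := by
  funext x y
  refine propext ⟨?_, fun h => Or.inr ⟨Nat.pair x y, by simpa using h, rfl⟩⟩
  rintro (⟨m, -, h⟩ | ⟨m, hm, h⟩)
  · omega
  · have : Nat.pair x y = m := by omega
    subst this
    simpa using hm

theorem relCode_coded (X : Set ℕ) : relCode (codedCarrier X) (codedRel X) = X := by
  ext k
  constructor
  · rintro (⟨m, hm, rfl⟩ | ⟨m, hm, rfl⟩)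
    · exact hm
    · simpa [codedRel] using hm
  · intro hk
    rcases Nat.even_or_odd' k with ⟨m, rfl | rfl⟩
    · exact Or.inl ⟨m, hk, rfl⟩
    · exact Or.inr ⟨m, by simpa [codedRel] using hk, rfl⟩

/-- `(P, r)` is a poset with `P ⊆ ℕ`: `r` is a reflexive, antisymmetric and transitive relation
on `P`, that is, a subset of `P × P`. -/
structure IsNatPoset (P : Set ℕ) (r : ℕ → ℕ → Prop) : Prop where
  mem_of_rel : ∀ x y, r x y → x ∈ P ∧ y ∈ P
  refl : ∀ x ∈ P, r x x
  antisymm : ∀ x y, r x y → r y x → x = y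
  trans : ∀ x y z, r x y → r y z → r x z

/-- The chain-antichain problem: an instance is (the code of) an infinite poset `(P, ≤_P)` with
`P ⊆ ℕ`; a solution is an infinite subset of `P` that is a chain or an antichain. -/
def CAC : InstanceSolutionProblem where
  IsInstance X := IsNatPoset (codedCarrier X) (codedRel X) ∧ (codedCarrier X).Infinite
  IsSolution X Y := Y ⊆ codedCarrier X ∧ Y.Infinite ∧
    (IsChain (codedRel X) Y ∨ IsAntichain (codedRel X) Y)

/-- The poset coded by `X` is `ω`-ordered: `x ≤_P y` implies `x ≤ y`. -/
def IsOmegaOrdered (X : Set ℕ) : Prop :=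
  ∀ x ∈ codedCarrier X, ∀ y ∈ codedCarrier X, codedRel X x y → x ≤ y

/-- The chain-antichain problem restricted to `ω`-ordered instances. -/
def omegaCAC : InstanceSolutionProblem := CAC.restrict IsOmegaOrdered

/-! The witness is a generic poset `s` on the natural numbers, built by finite-extension forcing; a
condition fixes the limit behaviour of finitely many elements: below almost all others, above almost
all, or incomparable to almost all. An element comparable to almost all others lies in no infinite
antichain, and an isolated one in no infinite chain. As `s` need not be `ω`-ordered, two distinct
new elements can be given any combination of "isolated" and "comparable to almost all"
(`exists_extension_relatedAs`).

Let `Z` be an `ω`-ordered poset computed from `s`. A chain and an antichain of `Z` are built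
together from one reservoir. Suppose a finite chain `E` lies below a finite antichain `G`, and that
with `E` and `G` added the two sides output excluded elements of `s`. If some `g ∈ G` has infinitely
many reservoir elements above it, all of these are above `E`, and `E` can be added. Otherwise almost
all of the reservoir is above no element of `G`, hence incomparable to `G` by the `ω`-order, and `G`
can be added. Either way one computation is spoiled. If no such pair exists, genericity stops one of
the two computations from having infinite output (`exists_forces`). Meeting this disjunction for all
pairs of codes makes one of the two limit sets a solution that computes no solution of `s`. -/

/-! ### Oracle computations and the use principle. -/

/-- Codes for partial functions that are recursive in an oracle. -/
inductive OracleCode : Type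
  | zero | succ | left | right | oracle
  | pair (a b : OracleCode)
  | comp (a b : OracleCode)
  | prec (a b : OracleCode)
  | rfind (a : OracleCode)
  deriving Countable

namespace OracleCode

/-- The partial function with a given code, relative to the oracle `g`. -/
def eval (g : ℕ →. ℕ) : OracleCode → ℕ →. ℕ
  | zero => fun _ => 0
  | succ => Nat.succ
  | left => fun n => (Nat.unpair n).1
  | right => fun n => (Nat.unpair n).2
  | oracle => g
  | pair a b => fun n => Nat.pair <$> eval g a n <*> eval g b n
  | comp a b => fun n => eval g b n >>= eval g a
  | prec a b => fun p =>
      let (x, n) := Nat.unpair p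
      n.rec (eval g a x) fun y IH => do
        let i ← IH
        eval g b (Nat.pair x (Nat.pair y i))
  | rfind a => fun x => Nat.rfind fun n => (fun m => m = 0) <$> eval g a (Nat.pair x n)

theorem exists_eval_eq {g f : ℕ →. ℕ} (h : Nat.RecursiveIn {g} f) :
    ∃ e : OracleCode, e.eval g = f := by
  induction h with
  | zero => exact ⟨zero, rfl⟩
  | succ => exact ⟨succ, rfl⟩
  | left => exact ⟨left, rfl⟩
  | right => exact ⟨right, rfl⟩
  | oracle g' hg => exact ⟨oracle, (Set.mem_singleton_iff.1 hg).symm⟩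
  | pair _ _ ha hb =>
    obtain ⟨a, rfl⟩ := ha
    obtain ⟨b, rfl⟩ := hb
    exact ⟨pair a b, rfl⟩
  | comp _ _ ha hb =>
    obtain ⟨a, rfl⟩ := ha
    obtain ⟨b, rfl⟩ := hb
    exact ⟨comp a b, rfl⟩
  | prec _ _ ha hb =>
    obtain ⟨a, rfl⟩ := ha
    obtain ⟨b, rfl⟩ := hb
    exact ⟨prec a b, rfl⟩
  | rfind _ ha =>
    obtain ⟨a, rfl⟩ := ha
    exact ⟨rfind a, rfl⟩

/-- The filter of the partial functions that agree with `g` on long initial segments. -/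
def agreeFilter (g : ℕ →. ℕ) : Filter (ℕ →. ℕ) :=
  ⨅ m : ℕ, Filter.principal {g' | ∀ i < m, g' i = g i}

/-- The principal sets are nested, so the infimum is directed. Stating use through a filter merges
the uses of subcomputations by intersection. -/
theorem eventually_agreeFilter {g : ℕ →. ℕ} {P : (ℕ →. ℕ) → Prop} :
    (∀ᶠ g' in agreeFilter g, P g') ↔ ∃ m : ℕ, ∀ g', (∀ i < m, g' i = g i) → P g' := by
  unfold agreeFilter
  rw [Filter.Eventually, Filter.mem_iInf_of_directed]
  · simp [Set.subset_def]
  · intro m n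
    refine ⟨max m n, ?_, ?_⟩ <;>
    · simp only [ge_iff_le, Filter.principal_mono]
      exact fun g' hg i hi => hg i (by omega)

/-- The use principle: a halting computation consults only finitely many oracle values. -/
theorem eventually_mem_eval (g : ℕ →. ℕ) (e : OracleCode) :
    ∀ n a, a ∈ e.eval g n → ∀ᶠ g' in agreeFilter g, a ∈ e.eval g' n := by
  induction e with
  | zero => exact fun n a h => .of_forall fun _ => h
  | succ => exact fun n a h => .of_forall fun _ => h
  | left => exact fun n a h => .of_forall fun _ => h
  | right => exact fun n a h => .of_forall fun _ => h
  | oracle =>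
    intro n a h
    refine eventually_agreeFilter.2 ⟨n + 1, fun g' hg => ?_⟩
    change a ∈ g' n
    rw [hg n (by omega)]
    exact h
  | pair a b iha ihb =>
    intro n c h
    simp only [eval, Seq.seq, Part.map_eq_map, Part.mem_bind_iff, Part.mem_map_iff] at h ⊢
    obtain ⟨f, ⟨x, hx, rfl⟩, y, hy, rfl⟩ := h
    filter_upwards [iha n x hx, ihb n y hy] with g' h1 h2
    exact ⟨_, ⟨x, h1, rfl⟩, y, h2, rfl⟩
  | comp a b iha ihb =>
    intro n c h
    obtain ⟨x, hx, hc⟩ := Part.mem_bind_iff.1 h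
    filter_upwards [ihb n x hx, iha x c hc] with g' h1 h2
    exact Part.mem_bind_iff.2 ⟨x, h1, h2⟩
  | prec a b iha ihb =>
    intro p
    simp only [eval]
    generalize (Nat.unpair p).1 = x
    induction (Nat.unpair p).2 with
    | zero => exact fun c h => iha x c h
    | succ n ih =>
      intro c h
      simp only [Part.bind_eq_bind, Part.mem_bind_iff] at h ⊢
      obtain ⟨i, hi, hc⟩ := h
      filter_upwards [ih i hi, ihb _ c hc] with g' h1 h2
      exact ⟨i, h1, h2⟩
  | rfind a iha =>
    intro x c h
    have mem_iff : ∀ g', c ∈ (rfind a).eval g' x ↔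
        (∃ y ∈ a.eval g' (Nat.pair x c), decide (y = 0) = true) ∧
        ∀ {m}, m < c → ∃ y ∈ a.eval g' (Nat.pair x m), decide (y = 0) = false := by
      intro g'
      refine Nat.mem_rfind.trans ?_
      simp only [Part.map_eq_map, Part.mem_map_iff]
    simp only [mem_iff] at h ⊢
    obtain ⟨⟨y, hy, hy'⟩, h2⟩ := h
    refine ((iha _ y hy).mono fun g' h1 => ⟨y, h1, hy'⟩).and ?_
    -- Minimality of `c` involves only the finitely many computations below `c`, so their uses can
    -- be merged.
    have : ∀ᶠ g' in agreeFilter g, ∀ m ∈ Finset.range c,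
        ∃ z ∈ a.eval g' (Nat.pair x m), decide (z = 0) = false := by
      rw [Filter.eventually_all_finset]
      intro m hm
      obtain ⟨z, hz, hz'⟩ := h2 (Finset.mem_range.1 hm)
      filter_upwards [iha _ z hz] with g' h1
      exact ⟨z, h1, hz'⟩
    filter_upwards [this] with g' hg m hm
    exact hg m (Finset.mem_range.2 hm)

/-- The set of inputs at which the computation with oracle `A` returns `1`. -/
def toSet (e : OracleCode) (A : Set ℕ) : Set ℕ := {k | 1 ∈ e.eval (charFun A) k}

end OracleCode

/-- A set that is Turing reducible to `A` is computed by a code, with finite use. -/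
theorem SetTuringReducible.exists_code {W A : Set ℕ} (h : SetTuringReducible W A) :
    ∃ e : OracleCode, e.toSet A = W ∧ ∀ k, ∃ m, ∀ A' : Set ℕ, (∀ i < m, i ∈ A' ↔ i ∈ A) →
      (k ∈ e.toSet A' ↔ k ∈ W) := by
  classical
  obtain ⟨e, he⟩ := OracleCode.exists_eval_eq (RecursiveIn.iff_nat.1 h)
  refine ⟨e, ?_, fun k => ?_⟩
  · ext k
    by_cases hk : k ∈ W <;> simp [OracleCode.toSet, he, charFun, hk]
  · have hmem : (if k ∈ W then 1 else 0) ∈ e.eval (charFun A) k := by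
      rw [he]
      exact Part.mem_some _
    obtain ⟨m, hm⟩ := OracleCode.eventually_agreeFilter.1 (e.eventually_mem_eval _ _ _ hmem)
    refine ⟨m, fun A' hA => ?_⟩
    have := hm (charFun A') fun i hi => by simp [charFun, hA i hi]
    constructor
    · intro h1
      by_contra hk
      rw [if_neg hk] at this
      exact absurd (Part.mem_unique h1 this) (by decide)
    · intro hk
      rwa [if_pos hk] at this

/-! ### Generic sequences and stable conditions. -/

/-- Rasiowa–Sikorski: below `p₀` there is an increasing sequence meeting countably many sets that
are cofinal above `p₀`. -/
theorem exists_monotone_meeting {P ι : Type*} [Preorder P] [Countable ι] (p₀ : P)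
    (D : ι → P → Prop) (hD : ∀ i p, p₀ ≤ p → ∃ q, p ≤ q ∧ D i q) :
    ∃ f : ℕ → P, Monotone f ∧ (∀ n, p₀ ≤ f n) ∧ ∀ i, ∃ n, D i (f n) := by
  have := Encodable.ofCountable ι
  let C : ι → Order.Cofinal (Set.Ici p₀) := fun i =>
    { carrier := {p | D i p}
      isCofinal := fun p => by
        obtain ⟨q, hq, hq'⟩ := hD i p p.2
        exact ⟨⟨q, le_trans p.2 hq⟩, hq', hq⟩ }
  let f := Order.sequenceOfCofinals (⟨p₀, le_refl p₀⟩ : Set.Ici p₀) C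
  exact ⟨fun n => f n, fun a b h => Order.sequenceOfCofinals.monotone _ C h, fun n => (f n).2,
    fun i => ⟨_, Order.sequenceOfCofinals.encode_mem _ C i⟩⟩

/-- A poset on `ℕ` in which each element below `n` has the same relation to all elements from `n`
on. -/
structure StableCondition where
  n : ℕ
  r : ℕ → ℕ → Prop
  poset : IsNatPoset Set.univ r
  stable : ∀ x < n, ∀ y ≥ n, (r x y ↔ r x n) ∧ (r y x ↔ r n x)

namespace StableCondition

/-- The relation `s` extends the part of `p` that involves an element below `p.n`. -/
def ExtendedBy (p : StableCondition) (s : ℕ → ℕ → Prop) : Prop :=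
  ∀ x y, x < p.n ∨ y < p.n → (p.r x y ↔ s x y)

instance : Preorder StableCondition where
  le p q := p.n ≤ q.n ∧ p.ExtendedBy q.r
  le_refl p := ⟨le_rfl, fun _ _ _ => Iff.rfl⟩
  le_trans p q t hpq hqt := ⟨hpq.1.trans hqt.1, fun x y h =>
    (hpq.2 x y h).trans (hqt.2 x y (h.imp hpq.1.trans_lt' hpq.1.trans_lt'))⟩

/-- The condition with the reversed order. -/
def flip (p : StableCondition) : StableCondition where
  n := p.n
  r x y := p.r y x
  poset := ⟨fun _ _ _ => ⟨trivial, trivial⟩, fun x hx => p.poset.refl x hx,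
    fun x y h h' => p.poset.antisymm x y h' h, fun x y z h h' => p.poset.trans z y x h' h⟩
  stable x hx y hy := (p.stable x hx y hy).symm

/-- An initial segment of a poset that extends `p` can be continued so that the new elements in
the lower set `D` are finally small and the other new elements are finally isolated. -/
theorem exists_extension_lower (p : StableCondition) {s : ℕ → ℕ → Prop}
    (hs : IsNatPoset Set.univ s) (hps : p.ExtendedBy s) {m : ℕ} (hm : p.n ≤ m) (D : Set ℕ)
    (hD : ∀ x y, p.n ≤ x → s x y → y ∈ D → x ∈ D) :
    ∃ q, p ≤ q ∧ q.n = m ∧ (∀ x < m, ∀ y < m, (q.r x y ↔ s x y)) ∧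
      ∀ x, p.n ≤ x → x < m → ∀ y ≥ m, (x ∈ D → q.r x y) ∧ (x ∉ D → ¬ q.r x y ∧ ¬ q.r y x) := by
  obtain ⟨n, r, hr, hst⟩ := p
  simp only [ExtendedBy] at hps hm hD ⊢
  -- The elements from `m` on become an antichain placed above `lo` and below `hi`. Old elements
  -- keep the limit behaviour they have at `n`.
  let lo : ℕ → Prop := fun x => (x < n ∧ r x n) ∨ (n ≤ x ∧ x ∈ D)
  let hi : ℕ → Prop := fun x => x < n ∧ r n x
  have lo_of_le : ∀ x y, s x y → lo y → lo x := by
    rintro x y hxy (⟨hy, hyn⟩ | ⟨hy, hyD⟩)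
    · have hxy' := (hps x y (.inr hy)).2 hxy
      rcases lt_or_ge x n with hx | hx
      · exact .inl ⟨hx, hr.trans _ _ _ hxy' hyn⟩
      -- By stability `x` may be replaced by `n`; then `y` and `n` lie below each other although `y
      -- < n`.
      · have := hr.antisymm _ _ hyn (((hst y hy x hx).2).1 hxy')
        omega
    · rcases lt_or_ge x n with hx | hx
      · exact .inl ⟨hx, ((hst x hx y hy).1).1 ((hps x y (.inl hx)).2 hxy)⟩
      · exact .inr ⟨hx, hD x y hx hxy hyD⟩
  have hi_of_le : ∀ x y, s x y → hi x → hi y := by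
    rintro x y hxy ⟨hx, hnx⟩
    have hxy' := (hps x y (.inl hx)).2 hxy
    rcases lt_or_ge y n with hy | hy
    · exact ⟨hy, hr.trans _ _ _ hnx hxy'⟩
    · have := hr.antisymm _ _ (((hst x hx y hy).1).1 hxy') hnx
      omega
  have le_of_lo_hi : ∀ x y, lo x → hi y → s x y := by
    rintro x y hx ⟨hy, hny⟩
    refine (hps x y (.inr hy)).1 ?_
    rcases hx with ⟨hx, hxn⟩ | ⟨hx, -⟩
    · exact hr.trans _ _ _ hxn hny
    · exact ((hst y hy x hx).2).2 hny
  have not_lo_hi : ∀ x, lo x → hi x → False := by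
    rintro x hx ⟨hx', hnx⟩
    rcases hx with ⟨hx, hxn⟩ | ⟨hx, -⟩
    · have := hr.antisymm _ _ hxn hnx
      omega
    · omega
  let t : ℕ → ℕ → Prop := fun x y => (x < m ∧ y < m ∧ s x y) ∨ (x < m ∧ m ≤ y ∧ lo x) ∨
    (m ≤ x ∧ y < m ∧ hi y) ∨ (m ≤ x ∧ x = y)
  have tll : ∀ x < m, ∀ y < m, (t x y ↔ s x y) := by
    intro x hx y hy
    simp only [t]
    constructor
    · rintro (h | h | h | h)
      · exact h.2.2
      all_goals omega
    · exact fun h => .inl ⟨hx, hy, h⟩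
  have tlg : ∀ x < m, ∀ y ≥ m, (t x y ↔ lo x) := by
    intro x hx y hy
    simp only [t]
    constructor
    · rintro (h | h | h | h)
      · omega
      · exact h.2.2
      all_goals omega
    · exact fun h => .inr (.inl ⟨hx, hy, h⟩)
  have tgl : ∀ x ≥ m, ∀ y < m, (t x y ↔ hi y) := by
    intro x hx y hy
    simp only [t]
    constructor
    · rintro (h | h | h | h)
      · omega
      · omega
      · exact h.2.2
      · omega
    · exact fun h => .inr (.inr (.inl ⟨hx, hy, h⟩))
  have tgg : ∀ x ≥ m, ∀ y ≥ m, (t x y ↔ x = y) := by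
    intro x hx y hy
    simp only [t]
    constructor
    · rintro (h | h | h | h) <;> omega
    · exact fun h => .inr (.inr (.inr ⟨hx, h⟩))
  have ht : IsNatPoset Set.univ t := by
    refine ⟨fun _ _ _ => ⟨trivial, trivial⟩, fun x _ => ?_, fun x y => ?_, fun x y z => ?_⟩
    · rcases lt_or_ge x m with hx | hx
      · exact (tll x hx x hx).2 (hs.refl x trivial)
      · exact (tgg x hx x hx).2 rfl
    · rcases lt_or_ge x m with hx | hx <;> rcases lt_or_ge y m with hy | hy
      · rw [tll x hx y hy, tll y hy x hx]
        exact hs.antisymm x y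
      · rw [tlg x hx y hy, tgl y hy x hx]
        exact fun h h' => (not_lo_hi x h h').elim
      · rw [tgl x hx y hy, tlg y hy x hx]
        exact fun h h' => (not_lo_hi y h' h).elim
      · rw [tgg x hx y hy]
        exact fun h _ => h
    · rcases lt_or_ge x m with hx | hx <;> rcases lt_or_ge y m with hy | hy <;>
        rcases lt_or_ge z m with hz | hz
      · rw [tll x hx y hy, tll y hy z hz, tll x hx z hz]
        exact hs.trans x y z
      · rw [tll x hx y hy, tlg y hy z hz, tlg x hx z hz]
        exact lo_of_le x y
      · rw [tlg x hx y hy, tgl y hy z hz, tll x hx z hz]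
        exact le_of_lo_hi x z
      · rw [tlg x hx y hy, tlg x hx z hz]
        exact fun h _ => h
      · rw [tgl x hx y hy, tll y hy z hz, tgl x hx z hz]
        exact fun h h' => hi_of_le y z h' h
      · rw [tgl x hx y hy, tlg y hy z hz]
        exact fun h h' => (not_lo_hi y h' h).elim
      · rw [tgl y hy z hz, tgl x hx z hz]
        exact fun _ h => h
      · rw [tgg x hx y hy, tgg y hy z hz, tgg x hx z hz]
        exact Eq.trans
  refine ⟨⟨m, t, ht, fun x hx y hy => ⟨?_, ?_⟩⟩, ⟨hm, fun x y hxy => ?_⟩, rfl, tll,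
    fun x hnx hxm y hy => ⟨fun h => (tlg x hxm y hy).2 (.inr ⟨hnx, h⟩), fun h => ⟨?_, ?_⟩⟩⟩
  · rw [tlg x hx y hy, tlg x hx m le_rfl]
  · rw [tgl y hy x hx, tgl m le_rfl x hx]
  · change x < n ∨ y < n at hxy
    change r x y ↔ t x y
    rcases lt_or_ge x m with hx | hx <;> rcases lt_or_ge y m with hy | hy
    · rw [tll x hx y hy, hps x y hxy]
    · have hxn : x < n := by omega
      rw [tlg x hx y hy, (hst x hxn y (by omega)).1]
      exact ⟨fun h => .inl ⟨hxn, h⟩, fun h => h.elim And.right fun h => by omega⟩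
    · have hyn : y < n := by omega
      rw [tgl x hx y hy, (hst y hyn x (by omega)).2]
      exact ⟨fun h => ⟨hyn, h⟩, And.right⟩
    · omega
  · rintro h'
    rcases (tlg x hxm y hy).1 h' with h' | h'
    · omega
    · exact h h'.2
  · exact fun h' => absurd ((tgl y hy x hxm).1 h').1 (by omega)

/-- This is the order dual, obtained by reversing all relations. -/
theorem exists_extension_upper (p : StableCondition) {s : ℕ → ℕ → Prop}
    (hs : IsNatPoset Set.univ s) (hps : p.ExtendedBy s) {m : ℕ} (hm : p.n ≤ m) (U : Set ℕ)
    (hU : ∀ x y, p.n ≤ y → s x y → x ∈ U → y ∈ U) :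
    ∃ q, p ≤ q ∧ q.n = m ∧ (∀ x < m, ∀ y < m, (q.r x y ↔ s x y)) ∧
      ∀ x, p.n ≤ x → x < m → ∀ y ≥ m, (x ∈ U → q.r y x) ∧ (x ∉ U → ¬ q.r x y ∧ ¬ q.r y x) := by
  obtain ⟨q, hpq, hqm, hqs, hq⟩ := p.flip.exists_extension_lower (s := fun x y => s y x)
    ⟨fun _ _ _ => ⟨trivial, trivial⟩, fun x hx => hs.refl x hx,
      fun x y h h' => hs.antisymm x y h' h, fun x y z h h' => hs.trans z y x h' h⟩
    (fun x y h => hps y x h.symm) hm U (fun x y hx h hy => hU y x hx h hy)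
  exact ⟨q.flip, ⟨hpq.1, fun x y h => hpq.2 y x h.symm⟩, hqm, fun x hx y hy => hqs y hy x hx,
    fun x hx hxm y hy => ⟨(hq x hx hxm y hy).1, fun h => ((hq x hx hxm y hy).2 h).symm⟩⟩

end StableCondition

/-! ### Excluded elements and the generic poset. -/

/-- `x` and `y` are incomparable (for `b = true`) or comparable (for `b = false`). -/
def RelatedAs (s : ℕ → ℕ → Prop) : Bool → ℕ → ℕ → Prop
  | true, x, y => ¬ s x y ∧ ¬ s y x
  | false, x, y => s x y ∨ s y x

/-- `W` is a chain (for `b = true`) or an antichain (for `b = false`). -/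
def HomogeneousAs (s : ℕ → ℕ → Prop) : Bool → Set ℕ → Prop
  | true, W => IsChain s W
  | false, W => IsAntichain s W

/-- Almost all elements are related to `x` in a way that excludes `x` from the infinite chains (for
`b = true`) or from the infinite antichains (for `b = false`). -/
def Excluded (s : ℕ → ℕ → Prop) (b : Bool) (x : ℕ) : Prop :=
  ∃ m, ∀ y ≥ m, RelatedAs s b x y

theorem Excluded.notMem {s : ℕ → ℕ → Prop} {b : Bool} {x : ℕ} (h : Excluded s b x) {W : Set ℕ}
    (hW : W.Infinite) (hb : HomogeneousAs s b W) : x ∉ W := by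
  intro hx
  obtain ⟨m, hm⟩ := h
  obtain ⟨y, hy, hmy⟩ := hW.exists_gt (max m x)
  have hne : x ≠ y := by omega
  have := hm y (by omega)
  cases b
  · exact this.elim (hb hx hy hne) (hb hy hx hne.symm)
  · exact (hb hx hy hne).elim this.1 this.2

/-- The mixed case needs `w` finally comparable and `v` finally isolated. Making `w` small also
makes everything below `w` small, and making it large also makes everything above it large; since `w
≠ v`, one of these two choices spares `v`. An `ω`-ordered poset would not allow the second choice.
-/
theorem StableCondition.exists_extension_relatedAs (p : StableCondition) {s : ℕ → ℕ → Prop}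
    (hs : IsNatPoset Set.univ s) (hps : p.ExtendedBy s) {m w v : ℕ} (hw : p.n ≤ w) (hv : p.n ≤ v)
    (hwm : w < m) (hvm : v < m) (hwv : w ≠ v) (b₀ b₁ : Bool) :
    ∃ q, p ≤ q ∧ q.n = m ∧ (∀ x < m, ∀ y < m, (q.r x y ↔ s x y)) ∧
      ∀ y ≥ m, RelatedAs q.r b₀ w y ∧ RelatedAs q.r b₁ v y := by
  have key : ∀ w v, p.n ≤ w → p.n ≤ v → w < m → v < m → w ≠ v → ∃ q, p ≤ q ∧ q.n = m ∧
      (∀ x < m, ∀ y < m, (q.r x y ↔ s x y)) ∧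
      ∀ y ≥ m, RelatedAs q.r false w y ∧ RelatedAs q.r true v y := by
    intro w v hw hv hwm hvm hwv
    by_cases h : s v w
    · obtain ⟨q, h1, h2, h3, h4⟩ := p.exists_extension_upper hs hps (hw.trans hwm.le) {x | s w x}
        (fun x y _ hxy hx => hs.trans _ _ _ hx hxy)
      exact ⟨q, h1, h2, h3, fun y hy => ⟨.inr ((h4 w hw hwm y hy).1 (hs.refl w trivial)),
        (h4 v hv hvm y hy).2 fun h' => hwv (hs.antisymm _ _ h' h)⟩⟩
    · obtain ⟨q, h1, h2, h3, h4⟩ := p.exists_extension_lower hs hps (hw.trans hwm.le) {x | s x w}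
        (fun x y _ hxy hy => hs.trans _ _ _ hxy hy)
      exact ⟨q, h1, h2, h3, fun y hy => ⟨.inl ((h4 w hw hwm y hy).1 (hs.refl w trivial)),
        (h4 v hv hvm y hy).2 h⟩⟩
  cases b₀ <;> cases b₁
  · obtain ⟨q, h1, h2, h3, h4⟩ := p.exists_extension_lower hs hps (hw.trans hwm.le) Set.univ
      (fun _ _ _ _ _ => trivial)
    exact ⟨q, h1, h2, h3, fun y hy => ⟨.inl ((h4 w hw hwm y hy).1 trivial),
      .inl ((h4 v hv hvm y hy).1 trivial)⟩⟩
  · exact key w v hw hv hwm hvm hwv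
  · obtain ⟨q, h1, h2, h3, h4⟩ := key v w hv hw hvm hwm hwv.symm
    exact ⟨q, h1, h2, h3, fun y hy => (h4 y hy).symm⟩
  · obtain ⟨q, h1, h2, h3, h4⟩ := p.exists_extension_lower hs hps (hw.trans hwm.le) ∅
      (fun _ _ _ _ h => h.elim)
    exact ⟨q, h1, h2, h3, fun y hy => ⟨(h4 w hw hwm y hy).2 id, (h4 v hv hvm y hy).2 id⟩⟩

/-- `Q` holds at all posets that agree with `s` on a certain initial segment. -/
def LocallyHolds (s : ℕ → ℕ → Prop) (Q : (ℕ → ℕ → Prop) → Prop) : Prop :=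
  ∃ m, ∀ s', IsNatPoset Set.univ s' → (∀ x < m, ∀ y < m, (s' x y ↔ s x y)) → Q s'

/-- A generic poset for countably many properties `Q i`: either there are excluded `w` and `v` with
`Q i s w v`, or no two large `w` and `v` satisfy `Q i s w v` locally. -/
theorem exists_generic_poset {ι : Type*} [Countable ι]
    (Q : ι → (ℕ → ℕ → Prop) → ℕ → ℕ → Prop) :
    ∃ s, IsNatPoset Set.univ s ∧ ∀ i b₀ b₁,
      (∃ w v, Q i s w v ∧ Excluded s b₀ w ∧ Excluded s b₁ v) ∨
      ∃ n, ∀ w ≥ n, ∀ v ≥ n, w ≠ v → ¬ LocallyHolds s fun s' => Q i s' w v := by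
  -- The left sets decide a requirement: either it holds with excluded witnesses, or it holds
  -- locally for no large pair in any extension. The right sets make `n` unbounded.
  let D : (ι × Bool × Bool) ⊕ ℕ → StableCondition → Prop := Sum.elim
    (fun i p =>
      (∃ w < p.n, ∃ v < p.n, (∀ s, IsNatPoset Set.univ s → p.ExtendedBy s → Q i.1 s w v) ∧
        ∀ y ≥ p.n, RelatedAs p.r i.2.1 w y ∧ RelatedAs p.r i.2.2 v y) ∨
      ∀ s, p.ExtendedBy s → IsNatPoset Set.univ s → ∀ w ≥ p.n, ∀ v ≥ p.n, w ≠ v →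
        ¬ LocallyHolds s fun s' => Q i.1 s' w v)
    (fun k p => k ≤ p.n)
  let p₀ : StableCondition := ⟨0, fun x y => x = y, ⟨fun _ _ _ => ⟨trivial, trivial⟩,
    fun _ _ => rfl, fun _ _ h _ => h, fun _ _ _ => Eq.trans⟩, fun x hx => absurd hx (by omega)⟩
  obtain ⟨f, hf, -, hfD⟩ := exists_monotone_meeting p₀ D (by
    rintro (⟨i, b₀, b₁⟩ | k) p -
    · by_cases h : ∀ s, p.ExtendedBy s → IsNatPoset Set.univ s → ∀ w ≥ p.n, ∀ v ≥ p.n, w ≠ v →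
          ¬ LocallyHolds s fun s' => Q i s' w v
      · exact ⟨p, le_rfl, .inr h⟩
      · push Not at h
        obtain ⟨s, hps, hs, w, hw, v, hv, hwv, m, hm⟩ := h
        -- The new length exceeds both witnesses and the initial segment of `s` that secures `Q`.
        obtain ⟨q, hpq, hqm, hqs, hq⟩ := p.exists_extension_relatedAs hs hps hw hv
          (m := max m (max w v) + 1) (by omega) (by omega) hwv b₀ b₁
        refine ⟨q, hpq, .inl ⟨w, by omega, v, by omega, fun s' hs' hqs' => hm s' hs' ?_, ?_⟩⟩
        · intro x hx y hy
          rw [← hqs' x y (.inl (by omega)), hqs x (by omega) y (by omega)]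
        · rw [hqm]
          exact hq
    · obtain ⟨q, hpq, hq, -⟩ := p.exists_extension_lower p.poset (fun _ _ _ => Iff.rfl)
        (m := max p.n k) (le_max_left _ _) ∅ (fun _ _ _ _ h => h.elim)
      exact ⟨q, hpq, by simp [D, hq]⟩)
  -- The guard matters: the relation of a condition is binding only where it involves an element
  -- below `n`.
  let s : ℕ → ℕ → Prop := fun x y => ∃ k, x < (f k).n ∧ (f k).r x y
  have hfs : ∀ k, (f k).ExtendedBy s := by
    intro k x y hxy
    have hl : ∀ l, x < (f l).n → ((f k).r x y ↔ (f l).r x y) := by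
      intro l hxl
      rcases le_total k l with h | h
      · exact (hf h).2 x y hxy
      · exact ((hf h).2 x y (.inl hxl)).symm
    constructor
    · intro h
      obtain ⟨l, hxl⟩ := hfD (.inr (x + 1))
      exact ⟨l, hxl, (hl l hxl).1 h⟩
    · rintro ⟨l, hxl, h⟩
      exact (hl l hxl).2 h
  have hs : IsNatPoset Set.univ s := by
    refine ⟨fun _ _ _ => ⟨trivial, trivial⟩, fun x _ => ?_, fun x y => ?_, fun x y z => ?_⟩
    · obtain ⟨k, hk⟩ := hfD (.inr (x + 1))
      exact (hfs k x x (.inl hk)).1 ((f k).poset.refl x trivial)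
    · obtain ⟨k, hk⟩ := hfD (.inr (x + 1))
      rw [← hfs k x y (.inl hk), ← hfs k y x (.inr hk)]
      exact (f k).poset.antisymm x y
    · obtain ⟨k, hk⟩ := hfD (.inr (max x y + 1))
      have hk' : max x y < (f k).n := hk
      rw [← hfs k x y (.inl (by omega)), ← hfs k y z (.inl (by omega)),
        ← hfs k x z (.inl (by omega))]
      exact (f k).poset.trans x y z
  refine ⟨s, hs, fun i b₀ b₁ => ?_⟩
  obtain ⟨k, hk⟩ := hfD (.inl (i, b₀, b₁))
  rcases hk with ⟨w, hw, v, hv, hQ, hr⟩ | h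
  · have tr : ∀ b x y, x < (f k).n → RelatedAs (f k).r b x y → RelatedAs s b x y := by
      intro b x y hx
      cases b <;> simp [RelatedAs, hfs k x y (.inl hx), hfs k y x (.inr hx)]
    exact .inl ⟨w, v, hQ s hs (hfs k), ⟨_, fun y hy => tr _ _ _ hw (hr y hy).1⟩,
      ⟨_, fun y hy => tr _ _ _ hv (hr y hy).2⟩⟩
  · exact .inr ⟨_, h s (hfs k) hs⟩

/-! ### Finite use of pairs of computations. -/

theorem effectiveJoin_agree {A A' B B' : Set ℕ} {m : ℕ} (hA : ∀ i < m, i ∈ A' ↔ i ∈ A)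
    (hB : ∀ i < m, i ∈ B' ↔ i ∈ B) (i : ℕ) (hi : i < m) :
    i ∈ effectiveJoin A' B' ↔ i ∈ effectiveJoin A B := by
  refine or_congr (exists_congr fun n => ?_) (exists_congr fun n => ?_)
  · exact and_congr_left fun h => hA n (by omega)
  · exact and_congr_left fun h => hB n (by omega)

theorem relCode_agree {s s' : ℕ → ℕ → Prop} {m : ℕ} (h : ∀ x < m, ∀ y < m, (s' x y ↔ s x y))
    (i : ℕ) (hi : i < m) : i ∈ relCode Set.univ s' ↔ i ∈ relCode Set.univ s :=
  effectiveJoin_agree (fun _ _ => Iff.rfl) (fun k hk => h _ ((Nat.unpair_left_le k).trans_lt hk) _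
    ((Nat.unpair_right_le k).trans_lt hk)) i hi

namespace OracleCode

/-- The computation with oracle `A` puts `w` into its output, using only oracle values below
`m`. -/
def OutputsBelow (e : OracleCode) (A : Set ℕ) (w m : ℕ) : Prop :=
  ∀ A' : Set ℕ, (∀ i < m, i ∈ A' ↔ i ∈ A) → w ∈ e.toSet A'

theorem OutputsBelow.congr {e : OracleCode} {A B : Set ℕ} {w m : ℕ} (h : e.OutputsBelow A w m)
    (hB : ∀ i < m, i ∈ B ↔ i ∈ A) : e.OutputsBelow B w m :=
  fun A' hA' => h A' fun i hi => (hA' i hi).trans (hB i hi)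

/-- A code for the constant function `1`. -/
def one : OracleCode := comp succ zero

theorem outputsBelow_one (A : Set ℕ) (w m : ℕ) : one.OutputsBelow A w m := by
  intro A' _
  exact Part.mem_bind_iff.2 ⟨0, Part.mem_some _, Part.mem_some _⟩

/-- With oracle `A`, the code `e` computes, with finite use, an infinite chain (for `b = true`) or
antichain (for `b = false`). -/
def ComputesHomogeneous (e : OracleCode) (A : Set ℕ) (s : ℕ → ℕ → Prop) (b : Bool) : Prop :=
  (e.toSet A).Infinite ∧ HomogeneousAs s b (e.toSet A) ∧ ∀ k ∈ e.toSet A, ∃ m, e.OutputsBelow A k m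

theorem ComputesHomogeneous.exists_outputsBelow {e : OracleCode} {A : Set ℕ} {s : ℕ → ℕ → Prop}
    {b : Bool} (h : e.ComputesHomogeneous A s b) (n : ℕ) :
    ∃ w > n, ∃ m, e.OutputsBelow A w m := by
  obtain ⟨w, hw, hn⟩ := h.1.exists_gt n
  exact ⟨w, hn, h.2.2 w hw⟩

theorem OutputsBelow.not_computesHomogeneous {e : OracleCode} {A B : Set ℕ} {s : ℕ → ℕ → Prop}
    {b : Bool} {w m : ℕ} (h : e.OutputsBelow A w m) (hw : Excluded s b w)
    (hB : ∀ i < m, i ∈ B ↔ i ∈ A) : ¬ e.ComputesHomogeneous B s b :=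
  fun hc => hw.notMem hc.1 hc.2.1 (h B hB)

end OracleCode

/-- The elements of the coded poset, not below `b`, that are above `A` and incomparable to `B`. -/
def reservoir (Z : Set ℕ) (A B : Finset ℕ) (b : ℕ) : Set ℕ :=
  {z | z ∈ codedCarrier Z ∧ b ≤ z ∧ (∀ a ∈ A, codedRel Z a z) ∧
    ∀ c ∈ B, ¬ codedRel Z c z ∧ ¬ codedRel Z z c}

/-- There are a finite chain `E` and a finite antichain `G` above it in the reservoir of the poset
computed by `d` for which the computations with `F₀ ∪ E` and `F₁ ∪ G` output `w` and `v`. -/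
def OutputsPair (d e₀ e₁ : OracleCode) (F₀ F₁ A : Finset ℕ) (b : ℕ) (s : ℕ → ℕ → Prop)
    (w v : ℕ) : Prop :=
  ∃ E G : Finset ℕ,
    (E : Set ℕ) ⊆ reservoir (d.toSet (relCode Set.univ s)) A F₁ b ∧
    (G : Set ℕ) ⊆ reservoir (d.toSet (relCode Set.univ s)) A F₁ b ∧
    IsChain (codedRel (d.toSet (relCode Set.univ s))) E ∧
    IsAntichain (codedRel (d.toSet (relCode Set.univ s))) G ∧
    (∀ x ∈ E, ∀ y ∈ G, codedRel (d.toSet (relCode Set.univ s)) x y) ∧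
    (∃ m, e₀.OutputsBelow (effectiveJoin (relCode Set.univ s) ((F₀ ∪ E : Finset ℕ) : Set ℕ)) w m) ∧
    ∃ m, e₁.OutputsBelow (effectiveJoin (relCode Set.univ s) ((F₁ ∪ G : Finset ℕ) : Set ℕ)) v m

/-- The code `d` computes `Z` from `A`, with finite use. -/
def OracleCode.Decides (d : OracleCode) (A Z : Set ℕ) : Prop :=
  d.toSet A = Z ∧ ∀ k, ∃ m, ∀ A' : Set ℕ, (∀ i < m, i ∈ A' ↔ i ∈ A) → (k ∈ d.toSet A' ↔ k ∈ Z)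

theorem OracleCode.Decides.exists_uniform {d : OracleCode} {A Z : Set ℕ} (h : d.Decides A Z)
    (K : ℕ) : ∃ m, ∀ A' : Set ℕ, (∀ i < m, i ∈ A' ↔ i ∈ A) →
      ∀ k < K, (k ∈ d.toSet A' ↔ k ∈ Z) := by
  choose u hu using h.2
  refine ⟨(Finset.range K).sup u, fun A' hA' k hk => hu k A' fun i hi => hA' i ?_⟩
  exact hi.trans_le (Finset.le_sup (f := u) (Finset.mem_range.2 hk))

/-- The reservoir is given by finite sets and a bound, and `E` and `G` are finite, so only finitely
many values of `Z` and two halting computations are involved. Hence a finite part of `s` suffices.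
-/
theorem locallyHolds_outputsPair {d e₀ e₁ : OracleCode} {F₀ F₁ A : Finset ℕ} {b : ℕ}
    {s : ℕ → ℕ → Prop} {w v : ℕ} {Z : Set ℕ} (hd : d.Decides (relCode Set.univ s) Z)
    (h : OutputsPair d e₀ e₁ F₀ F₁ A b s w v) :
    LocallyHolds s fun s' => OutputsPair d e₀ e₁ F₀ F₁ A b s' w v := by
  obtain ⟨E, G, hE, hG, hEc, hGa, hEG, ⟨m₀, h₀⟩, ⟨m₁, h₁⟩⟩ := h
  obtain ⟨M, hM⟩ : ∃ M, ∀ x ∈ E ∪ G ∪ F₁ ∪ A, x < M :=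
    ⟨(E ∪ G ∪ F₁ ∪ A).sup id + 1, fun x hx => Nat.lt_succ_of_le (Finset.le_sup (f := id) hx)⟩
  have hME : ∀ x ∈ E, x < M := fun x hx => hM x (by simp [hx])
  have hMG : ∀ x ∈ G, x < M := fun x hx => hM x (by simp [hx])
  have hMF : ∀ x ∈ F₁, x < M := fun x hx => hM x (by simp [hx])
  have hMA : ∀ x ∈ A, x < M := fun x hx => hM x (by simp [hx])
  -- Elements below `M` have code `2 * x`, and pairs of them have code `2 * Nat.pair x y + 1` with
  -- `Nat.pair x y < M ^ 2`; all these codes are below the chosen bound.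
  obtain ⟨m, hm⟩ := hd.exists_uniform (2 * M ^ 2 + 2 * M + 2)
  refine ⟨max m (max m₀ m₁), fun s' _ hs' => ?_⟩
  have agree := relCode_agree hs'
  rw [hd.1] at hE hG hEc hGa hEG
  have hZ := hm _ fun i hi => agree i (by omega)
  have hcar : ∀ x < M, (x ∈ codedCarrier (d.toSet (relCode Set.univ s')) ↔ x ∈ codedCarrier Z) :=
    fun x hx => hZ _ (by nlinarith)
  have hrel : ∀ x < M, ∀ y < M,
      (codedRel (d.toSet (relCode Set.univ s')) x y ↔ codedRel Z x y) := by
    intro x hx y hy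
    refine hZ _ ?_
    have h1 := Nat.pair_lt_max_add_one_sq x y
    have h2 : (max x y + 1) ^ 2 ≤ M ^ 2 := Nat.pow_le_pow_left (by omega) 2
    omega
  have hres : ∀ x < M, x ∈ reservoir Z A F₁ b →
      x ∈ reservoir (d.toSet (relCode Set.univ s')) A F₁ b := by
    rintro x hx ⟨h1, h2, h3, h4⟩
    refine ⟨(hcar x hx).2 h1, h2, fun a ha => (hrel a (hMA a ha) x hx).2 (h3 a ha), fun c hc => ?_⟩
    rw [hrel c (hMF c hc) x hx, hrel x hx c (hMF c hc)]
    exact h4 c hc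
  refine ⟨E, G, fun x hx => hres x (hME x hx) (hE hx), fun x hx => hres x (hMG x hx) (hG hx),
    fun x hx y hy hne => ?_, fun x hx y hy hne => ?_, fun x hx y hy => ?_, ⟨m₀, h₀.congr ?_⟩,
    ⟨m₁, h₁.congr ?_⟩⟩
  · exact (hEc hx hy hne).imp (hrel x (hME x hx) y (hME y hy)).2 (hrel y (hME y hy) x (hME x hx)).2
  · change ¬ _
    rw [hrel x (hMG x hx) y (hMG y hy)]
    exact hGa hx hy hne
  · rw [hrel x (hME x hx) y (hMG y hy)]
    exact hEG x hx y hy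
  · exact effectiveJoin_agree (fun i hi => agree i (by omega)) fun _ _ => Iff.rfl
  · exact effectiveJoin_agree (fun i hi => agree i (by omega)) fun _ _ => Iff.rfl

/-! ### Forcing a chain and an antichain with a common reservoir. -/

/-- A finite chain `F true`, a finite antichain `F false` and an infinite reservoir for both. -/
structure BiCondition (Z : Set ℕ) where
  F : Bool → Finset ℕ
  A : Finset ℕ
  bound : ℕ
  subset_carrier : ∀ t, (F t : Set ℕ) ⊆ codedCarrier Z
  homogeneous : ∀ t, HomogeneousAs (codedRel Z) t (F t)
  subset_A : F true ⊆ A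
  lt_bound : ∀ t, ∀ x ∈ F t, x < bound
  infinite : (reservoir Z A (F false) bound).Infinite

namespace BiCondition

variable {Z : Set ℕ}

/-- The reservoir of a condition. -/
def res (c : BiCondition Z) : Set ℕ := reservoir Z c.A (c.F false) c.bound

instance : Preorder (BiCondition Z) where
  le c c' := (∀ t, c.F t ⊆ c'.F t ∧ (c'.F t : Set ℕ) ⊆ c.F t ∪ c.res) ∧ c'.res ⊆ c.res
  le_refl c := ⟨fun _ => ⟨subset_rfl, Set.subset_union_left⟩, subset_rfl⟩
  le_trans c c' c'' h h' := ⟨fun t => ⟨(h.1 t).1.trans (h'.1 t).1, (h'.1 t).2.trans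
    (Set.union_subset (h.1 t).2 (h.2.trans Set.subset_union_right))⟩, h'.2.trans h.2⟩

theorem infinite_res (c : BiCondition Z) : c.res.Infinite := c.infinite

theorem infinite_sep_ge {R : Set ℕ} (h : R.Infinite) (k : ℕ) : {z ∈ R | k ≤ z}.Infinite := by
  refine Set.infinite_of_forall_exists_gt fun a => ?_
  obtain ⟨z, hz, haz⟩ := h.exists_gt (max a k)
  exact ⟨z, ⟨hz, by omega⟩, by omega⟩

theorem exists_le_chain (c : BiCondition Z) (E : Finset ℕ) (hE : (E : Set ℕ) ⊆ c.res)
    (hc : IsChain (codedRel Z) (E : Set ℕ)) (hinf : {z ∈ c.res | ∀ x ∈ E, codedRel Z x z}.Infinite)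
    (k : ℕ) : ∃ c', c ≤ c' ∧ c'.F true = c.F true ∪ E ∧ ∀ z ∈ c'.res, k ≤ z := by
  have hsub : reservoir Z (c.A ∪ E) (c.F false) (max c.bound (max k (E.sup id + 1))) =
      {z ∈ {z ∈ c.res | ∀ x ∈ E, codedRel Z x z} | max k (E.sup id + 1) ≤ z} := by
    ext z
    simp only [reservoir, res, Set.mem_ofPred_eq, Finset.mem_union, or_imp, forall_and,
      max_le_iff]
    tauto
  refine ⟨⟨fun t => match t with
      | true => c.F true ∪ E
      | false => c.F false, c.A ∪ E, max c.bound (max k (E.sup id + 1)), ?_, ?_, ?_, ?_, ?_⟩,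
    ⟨?_, ?_⟩, rfl, ?_⟩
  · rintro (_ | _)
    · exact c.subset_carrier false
    · simp only [Finset.coe_union]
      exact Set.union_subset (c.subset_carrier true) fun x hx => (hE hx).1
  · rintro (_ | _)
    · exact c.homogeneous false
    · simp only [Finset.coe_union]
      rintro x (hx | hx) y (hy | hy) hne
      · exact c.homogeneous true hx hy hne
      · exact .inl ((hE hy).2.2.1 x (c.subset_A hx))
      · exact .inr ((hE hx).2.2.1 y (c.subset_A hy))
      · exact hc hx hy hne
  · exact Finset.union_subset_union c.subset_A subset_rfl
  · rintro (_ | _) x hx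
    · exact (c.lt_bound false x hx).trans_le (le_max_left _ _)
    · rcases Finset.mem_union.1 hx with hx | hx
      · exact (c.lt_bound true x hx).trans_le (le_max_left _ _)
      · have : x ≤ E.sup id := Finset.le_sup (f := id) hx
        omega
  · rw [hsub]
    exact infinite_sep_ge hinf _
  · rintro (_ | _)
    · exact ⟨subset_rfl, Set.subset_union_left⟩
    · refine ⟨Finset.subset_union_left, ?_⟩
      simp only [Finset.coe_union]
      exact Set.union_subset_union subset_rfl hE
  · change reservoir _ _ _ _ ⊆ _
    rw [hsub]
    exact fun z hz => hz.1.1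
  · intro z hz
    have := hz.2.1
    change max c.bound (max k (E.sup id + 1)) ≤ z at this
    omega

/-- The reservoir is moved above `E` without adding `E` to the chain. This is why `A` may be larger
than `F true`. -/
theorem exists_le_above (c : BiCondition Z) (E : Finset ℕ)
    (hinf : {z ∈ c.res | ∀ x ∈ E, codedRel Z x z}.Infinite) (k : ℕ) :
    ∃ c', c ≤ c' ∧ c'.F = c.F ∧ ∀ z ∈ c'.res, k ≤ z ∧ ∀ x ∈ E, codedRel Z x z := by
  have hsub : reservoir Z (c.A ∪ E) (c.F false) (max c.bound k) =
      {z ∈ {z ∈ c.res | ∀ x ∈ E, codedRel Z x z} | k ≤ z} := by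
    ext z
    simp only [reservoir, res, Set.mem_ofPred_eq, Finset.mem_union, or_imp, forall_and,
      max_le_iff]
    tauto
  refine ⟨⟨c.F, c.A ∪ E, max c.bound k, c.subset_carrier, c.homogeneous,
    c.subset_A.trans Finset.subset_union_left,
    fun t x hx => (c.lt_bound t x hx).trans_le (le_max_left _ _), ?_⟩,
    ⟨fun t => ⟨subset_rfl, Set.subset_union_left⟩, ?_⟩, rfl, ?_⟩
  · rw [hsub]
    exact infinite_sep_ge hinf _
  · change reservoir _ _ _ _ ⊆ _
    rw [hsub]
    exact fun z hz => hz.1.1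
  · intro z hz
    change z ∈ reservoir _ _ _ _ at hz
    rw [hsub] at hz
    exact ⟨hz.2, hz.1.2⟩

theorem exists_le_antichain (hω : IsOmegaOrdered Z) (c : BiCondition Z) (G : Finset ℕ)
    (hG : (G : Set ℕ) ⊆ c.res) (ha : IsAntichain (codedRel Z) (G : Set ℕ))
    (hinf : {z ∈ c.res | ∀ x ∈ G, ¬ codedRel Z x z}.Infinite) (k : ℕ) :
    ∃ c', c ≤ c' ∧ c'.F false = c.F false ∪ G ∧ ∀ z ∈ c'.res, k ≤ z := by
  have hsub : reservoir Z c.A (c.F false ∪ G) (max c.bound (max k (G.sup id + 1))) =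
      {z ∈ {z ∈ c.res | ∀ x ∈ G, ¬ codedRel Z x z} | max k (G.sup id + 1) ≤ z} := by
    ext z
    -- Beyond the maximum of `G` the `ω`-order excludes `z` below `x`, so "not above" already means
    -- "incomparable".
    have : max k (G.sup id + 1) ≤ z → z ∈ codedCarrier Z → ∀ x ∈ G, ¬ codedRel Z z x := by
      intro hz hzc x hx hzx
      have h1 := hω z hzc x (hG hx).1 hzx
      have h2 : x ≤ G.sup id := Finset.le_sup (f := id) hx
      omega
    simp only [reservoir, res, Set.mem_ofPred_eq, Finset.mem_union, or_imp, forall_and]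
    rw [max_le_iff]
    tauto
  refine ⟨⟨fun t => match t with
      | true => c.F true
      | false => c.F false ∪ G, c.A, max c.bound (max k (G.sup id + 1)), ?_, ?_, ?_, ?_, ?_⟩,
    ⟨?_, ?_⟩, rfl, ?_⟩
  · rintro (_ | _)
    · simp only [Finset.coe_union]
      exact Set.union_subset (c.subset_carrier false) fun x hx => (hG hx).1
    · exact c.subset_carrier true
  · rintro (_ | _)
    · simp only [Finset.coe_union]
      rintro x (hx | hx) y (hy | hy) hne
      · exact c.homogeneous false hx hy hne
      · exact ((hG hy).2.2.2 x hx).1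
      · exact ((hG hx).2.2.2 y hy).2
      · exact ha hx hy hne
    · exact c.homogeneous true
  · exact c.subset_A
  · rintro (_ | _) x hx
    · rcases Finset.mem_union.1 hx with hx | hx
      · exact (c.lt_bound false x hx).trans_le (le_max_left _ _)
      · have : x ≤ G.sup id := Finset.le_sup (f := id) hx
        omega
    · exact (c.lt_bound true x hx).trans_le (le_max_left _ _)
  · rw [hsub]
    exact infinite_sep_ge hinf _
  · rintro (_ | _)
    · refine ⟨Finset.subset_union_left, ?_⟩
      simp only [Finset.coe_union]
      exact Set.union_subset_union subset_rfl hG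
    · exact ⟨subset_rfl, Set.subset_union_left⟩
  · change reservoir _ _ _ _ ⊆ _
    rw [hsub]
    exact fun z hz => hz.1.1
  · intro z hz
    have := hz.2.1
    change max c.bound (max k (G.sup id + 1)) ≤ z at this
    omega

theorem infinite_forall {R : Set ℕ} (hR : R.Infinite) (G : Finset ℕ) (p : ℕ → ℕ → Prop)
    (h : ∀ g ∈ G, {z ∈ R | ¬ p g z}.Finite) : {z ∈ R | ∀ g ∈ G, p g z}.Infinite := by
  intro hf
  refine hR ((hf.union (G.finite_toSet.biUnion h)).subset fun z hz => ?_)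
  by_cases hp : ∀ g ∈ G, p g z
  · exact .inl ⟨hz, hp⟩
  · push Not at hp
    obtain ⟨g, hg, hgz⟩ := hp
    exact .inr (Set.mem_biUnion hg ⟨hz, hgz⟩)

/-- `H` is an infinite chain or antichain that is compatible with the condition. -/
structure Compatible (c : BiCondition Z) (t : Bool) (H : Set ℕ) : Prop where
  infinite : H.Infinite
  homogeneous : HomogeneousAs (codedRel Z) t H
  subset : (c.F t : Set ℕ) ⊆ H
  subset_union : H ⊆ c.F t ∪ c.res

/-- No compatible set of type `t` computes, together with `s`, a homogeneous set of type `b` for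
`s` by means of `e`. -/
def Forces (c : BiCondition Z) (s : ℕ → ℕ → Prop) (t : Bool) (e : OracleCode) (b : Bool) : Prop :=
  ∀ H, c.Compatible t H →
    ¬ e.ComputesHomogeneous (effectiveJoin (relCode Set.univ s) H) s b

theorem Compatible.agree {c : BiCondition Z} {t : Bool} {H : Set ℕ} (h : c.Compatible t H) {m : ℕ}
    (hm : ∀ z ∈ c.res, m ≤ z) (i : ℕ) (hi : i < m) : i ∈ H ↔ i ∈ (c.F t : Set ℕ) :=
  ⟨fun hH => (h.subset_union hH).resolve_right fun hr => absurd (hm i hr) (by omega),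
    fun hF => h.subset hF⟩

theorem Compatible.exists_initial {c : BiCondition Z} {t : Bool} {H : Set ℕ}
    (h : c.Compatible t H) (m : ℕ) : ∃ E : Finset ℕ, (E : Set ℕ) ⊆ H ∧ (E : Set ℕ) ⊆ c.res ∧
      ∀ i < m, (i ∈ ((c.F t ∪ E : Finset ℕ) : Set ℕ) ↔ i ∈ H) := by
  classical
  refine ⟨(Finset.range m).filter fun i => i ∈ H ∧ i ∉ c.F t, fun i hi => ?_, fun i hi => ?_,
    fun i hi => ?_⟩
  · simp only [Finset.coe_filter, Set.mem_ofPred_eq] at hi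
    exact hi.2.1
  · simp only [Finset.coe_filter, Set.mem_ofPred_eq] at hi
    exact (h.subset_union hi.2.1).resolve_left hi.2.2
  · simp only [Finset.coe_union, Finset.coe_filter, Finset.mem_range, Set.mem_union,
      Finset.mem_coe, Set.mem_ofPred_eq]
    constructor
    · rintro (hF | hF)
      · exact h.subset hF
      · exact hF.2.1
    · intro hH
      by_cases hF : i ∈ c.F t
      · exact .inl hF
      · exact .inr ⟨hi, hH, hF⟩

theorem Compatible.exists_outputsBelow {c : BiCondition Z} {t : Bool} {H : Set ℕ}
    (h : c.Compatible t H) {e : OracleCode} {s : ℕ → ℕ → Prop} {b : Bool}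
    (he : e.ComputesHomogeneous (effectiveJoin (relCode Set.univ s) H) s b) (n : ℕ) :
    ∃ w > n, ∃ E : Finset ℕ, (E : Set ℕ) ⊆ H ∧ (E : Set ℕ) ⊆ c.res ∧
      ∃ m, e.OutputsBelow
        (effectiveJoin (relCode Set.univ s) ((c.F t ∪ E : Finset ℕ) : Set ℕ)) w m := by
  obtain ⟨w, hw, m, hm⟩ := he.exists_outputsBelow n
  obtain ⟨E, h1, h2, h3⟩ := h.exists_initial m
  exact ⟨w, hw, E, h1, h2, m, hm.congr (effectiveJoin_agree (fun _ _ => Iff.rfl) h3)⟩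

/-- Elements of `H` beyond `E` are comparable to all of `E`, and by the `ω`-order they can only be
above. -/
theorem Compatible.isChain_above (hω : IsOmegaOrdered Z) {c : BiCondition Z} {H : Set ℕ}
    (h : c.Compatible true H) {E : Finset ℕ} (hEH : (E : Set ℕ) ⊆ H) (hE : (E : Set ℕ) ⊆ c.res) :
    {z ∈ c.res | ∀ x ∈ E, codedRel Z x z}.Infinite := by
  refine Set.infinite_of_forall_exists_gt fun a => ?_
  obtain ⟨z, hz, haz⟩ := h.infinite.exists_gt (max (max a c.bound) (E.sup id))
  have hzr : z ∈ c.res := (h.subset_union hz).resolve_left fun hF =>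
    absurd (c.lt_bound true z hF) (by omega)
  refine ⟨z, ⟨hzr, fun x hx => ?_⟩, by omega⟩
  have hxz : x ≤ E.sup id := Finset.le_sup (f := id) hx
  refine (h.homogeneous (hEH hx) hz (by omega)).resolve_right fun hr => ?_
  exact absurd (hω z hzr.1 x (hE hx).1 hr) (by omega)

/-- Once the reservoir starts beyond the use, every compatible set preserves the computation, and so
outputs an element that no infinite homogeneous set of type `b` contains. -/
theorem forces_of_outputsBelow {c : BiCondition Z} {s : ℕ → ℕ → Prop} {t : Bool} {e : OracleCode}
    {b : Bool} {w m : ℕ} (hw : Excluded s b w)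
    (h : e.OutputsBelow (effectiveJoin (relCode Set.univ s) (c.F t)) w m)
    (hm : ∀ z ∈ c.res, m ≤ z) : c.Forces s t e b := fun _ hH =>
  h.not_computesHomogeneous hw (effectiveJoin_agree (fun _ _ => Iff.rfl) (hH.agree hm))

/-- With excluded outputs at hand, `E` or `G` can be added. Otherwise an extendible `E` with a large
output is sought: if one exists, a large output on the antichain side above `E` would complete a
forbidden pair; if none exists, no compatible chain has large outputs. -/
theorem exists_forces {s : ℕ → ℕ → Prop} {d : OracleCode}
    (hZ : IsNatPoset (codedCarrier Z) (codedRel Z)) (hω : IsOmegaOrdered Z)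
    (hd : d.Decides (relCode Set.univ s) Z)
    (c : BiCondition Z) (e₀ e₁ : OracleCode) (b₀ b₁ : Bool)
    (hgen : (∃ w v, OutputsPair d e₀ e₁ (c.F true) (c.F false) c.A c.bound s w v ∧
        Excluded s b₀ w ∧ Excluded s b₁ v) ∨
      ∃ n, ∀ w ≥ n, ∀ v ≥ n, w ≠ v → ¬ LocallyHolds s fun s' =>
        OutputsPair d e₀ e₁ (c.F true) (c.F false) c.A c.bound s' w v) :
    ∃ c', c ≤ c' ∧ (c'.Forces s true e₀ b₀ ∨ c'.Forces s false e₁ b₁) := by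
  rcases hgen with ⟨w, v, ⟨E, G, hE, hG, hEc, hGa, hEG, ⟨m₀, h₀⟩, ⟨m₁, h₁⟩⟩, hw, hv⟩ | ⟨n, hn⟩
  · rw [hd.1] at hE hG hEc hGa hEG
    by_cases h : ∃ g ∈ G, {z ∈ c.res | codedRel Z g z}.Infinite
    · obtain ⟨g, hg, hgi⟩ := h
      obtain ⟨c', hcc', hF, hm⟩ := c.exists_le_chain E hE hEc (hgi.mono fun z hz =>
        ⟨hz.1, fun x hx => hZ.trans _ _ _ (hEG x hx g hg) hz.2⟩) m₀
      exact ⟨c', hcc', .inl (forces_of_outputsBelow hw (hF ▸ h₀) hm)⟩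
    · push Not at h
      obtain ⟨c', hcc', hF, hm⟩ := c.exists_le_antichain hω G hG hGa
        (infinite_forall c.infinite_res G (fun g z => ¬ codedRel Z g z) (by simpa using h)) m₁
      exact ⟨c', hcc', .inr (forces_of_outputsBelow hv (hF ▸ h₁) hm)⟩
  · by_cases h : ∃ E : Finset ℕ, (E : Set ℕ) ⊆ c.res ∧ IsChain (codedRel Z) (E : Set ℕ) ∧
        {z ∈ c.res | ∀ x ∈ E, codedRel Z x z}.Infinite ∧ ∃ w ≥ n, ∃ m, e₀.OutputsBelow
          (effectiveJoin (relCode Set.univ s) ((c.F true ∪ E : Finset ℕ) : Set ℕ)) w m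
    · obtain ⟨E, hE, hEc, hinf, w, hw, hm⟩ := h
      obtain ⟨c', hcc', hF, habove⟩ := c.exists_le_above E hinf 0
      refine ⟨c', hcc', .inr fun H hH he => ?_⟩
      -- Going beyond `w` gives `w ≠ v`, which the generic alternative requires.
      obtain ⟨v, hv, G, hGH, hG, hm'⟩ := hH.exists_outputsBelow he (max n w)
      refine hn w hw v (by omega) (by omega) (locallyHolds_outputsPair hd ⟨E, G, ?_⟩)
      rw [hd.1]
      exact ⟨hE, hG.trans hcc'.2, hEc, IsAntichain.subset hH.homogeneous hGH,
        fun x hx y hy => (habove y (hG hy)).2 x hx, hm, hF ▸ hm'⟩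
    · refine ⟨c, le_rfl, .inl fun H hH he => h ?_⟩
      obtain ⟨w, hw, E, hEH, hE, hm⟩ := hH.exists_outputsBelow he n
      exact ⟨E, hE, IsChain.mono hEH hH.homogeneous, hH.isChain_above hω hEH hE, w, hw.le, hm⟩

/-- If no element of the reservoir can be put into the chain, then the antichain side alone can be
forced. -/
theorem exists_forces_antichain {s : ℕ → ℕ → Prop} {d : OracleCode}
    (hω : IsOmegaOrdered Z) (hd : d.Decides (relCode Set.univ s) Z)
    (c : BiCondition Z)
    (hc : ∀ x ∈ c.res, {z ∈ c.res | codedRel Z x z}.Finite) (e : OracleCode) (b : Bool)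
    (hgen : (∃ w v, OutputsPair d .one e (c.F true) (c.F false) c.A c.bound s w v ∧
        Excluded s b w ∧ Excluded s b v) ∨
      ∃ n, ∀ w ≥ n, ∀ v ≥ n, w ≠ v → ¬ LocallyHolds s fun s' =>
        OutputsPair d .one e (c.F true) (c.F false) c.A c.bound s' w v) :
    ∃ c', c ≤ c' ∧ c'.Forces s false e b := by
  rcases hgen with ⟨w, v, ⟨E, G, -, hG, -, hGa, -, -, ⟨m₁, h₁⟩⟩, -, hv⟩ | ⟨n, hn⟩
  · rw [hd.1] at hG hGa
    obtain ⟨c', hcc', hF, hm⟩ := c.exists_le_antichain hω G hG hGa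
      (infinite_forall c.infinite_res G (fun g z => ¬ codedRel Z g z)
        (by simpa using fun g hg => hc g (hG hg))) m₁
    exact ⟨c', hcc', forces_of_outputsBelow hv (hF ▸ h₁) hm⟩
  · refine ⟨c, le_rfl, fun H hH he => ?_⟩
    obtain ⟨v, hv, G, hGH, hG, hm⟩ := hH.exists_outputsBelow he n
    -- The code `one` outputs everything, so the chain side is satisfied by `E = ∅` and any large
    -- number other than `v`.
    refine hn (v + 1) (by omega) v (by omega) (by omega)
      (locallyHolds_outputsPair hd ⟨∅, G, ?_⟩)
    rw [hd.1]
    exact ⟨by simp, hG, by simp, IsAntichain.subset hH.homogeneous hGH, by simp,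
      ⟨0, OracleCode.outputsBelow_one _ _ _⟩, hm⟩

/-- If no element of the reservoir can be put into the antichain, then the chain side alone can be
forced. -/
theorem exists_forces_chain {s : ℕ → ℕ → Prop} {d : OracleCode}
    (hd : d.Decides (relCode Set.univ s) Z)
    (c : BiCondition Z)
    (hc : ∀ x ∈ c.res, {z ∈ c.res | ¬ codedRel Z x z}.Finite) (e : OracleCode) (b : Bool)
    (hgen : (∃ w v, OutputsPair d e .one (c.F true) (c.F false) c.A c.bound s w v ∧
        Excluded s b w ∧ Excluded s b v) ∨
      ∃ n, ∀ w ≥ n, ∀ v ≥ n, w ≠ v → ¬ LocallyHolds s fun s' =>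
        OutputsPair d e .one (c.F true) (c.F false) c.A c.bound s' w v) :
    ∃ c', c ≤ c' ∧ c'.Forces s true e b := by
  rcases hgen with ⟨w, v, ⟨E, G, hE, -, hEc, -, -, ⟨m₀, h₀⟩, -⟩, hw, -⟩ | ⟨n, hn⟩
  · rw [hd.1] at hE hEc
    obtain ⟨c', hcc', hF, hm⟩ := c.exists_le_chain E hE hEc
      (infinite_forall c.infinite_res E (codedRel Z) fun g hg => hc g (hE hg)) m₀
    exact ⟨c', hcc', forces_of_outputsBelow hw (hF ▸ h₀) hm⟩
  · refine ⟨c, le_rfl, fun H hH he => ?_⟩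
    obtain ⟨w, hw, E, hEH, hE, hm⟩ := hH.exists_outputsBelow he n
    refine hn w (by omega) (w + 1) (by omega) (by omega)
      (locallyHolds_outputsPair hd ⟨E, ∅, ?_⟩)
    rw [hd.1]
    exact ⟨hE, by simp, IsChain.mono hEH hH.homogeneous, by simp, by simp, hm,
      ⟨0, OracleCode.outputsBelow_one _ _ _⟩⟩

/-! ### Solutions as limits of generic sequences. -/

/-- The union of the finite sets of an increasing sequence is compatible with each condition. -/
theorem compatible_iUnion {f : ℕ → BiCondition Z} (hf : Monotone f) {t : Bool}
    (hlen : ∀ k, ∃ n, ∃ x ∈ (f n).F t, k ≤ x) (n : ℕ) :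
    (f n).Compatible t (⋃ n, ((f n).F t : Set ℕ)) := by
  have hmono : Monotone fun n => ((f n).F t : Set ℕ) := fun a b h x hx => ((hf h).1 t).1 hx
  refine ⟨Set.infinite_of_forall_exists_gt fun a => ?_, ?_, Set.subset_iUnion_of_subset n subset_rfl,
    Set.iUnion_subset fun k => ?_⟩
  · obtain ⟨n, x, hx, hax⟩ := hlen (a + 1)
    exact ⟨x, Set.mem_iUnion_of_mem n hx, by omega⟩
  · have pick : ∀ x ∈ ⋃ n, ((f n).F t : Set ℕ), ∀ y ∈ ⋃ n, ((f n).F t : Set ℕ),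
        ∃ n, x ∈ ((f n).F t : Set ℕ) ∧ y ∈ ((f n).F t : Set ℕ) := by
      intro x hx y hy
      obtain ⟨a, ha⟩ := Set.mem_iUnion.1 hx
      obtain ⟨b, hb⟩ := Set.mem_iUnion.1 hy
      exact ⟨max a b, hmono (le_max_left a b) ha, hmono (le_max_right a b) hb⟩
    cases t
    · intro x hx y hy hne
      obtain ⟨n, hxn, hyn⟩ := pick x hx y hy
      exact (f n).homogeneous false hxn hyn hne
    · intro x hx y hy hne
      obtain ⟨n, hxn, hyn⟩ := pick x hx y hy
      exact (f n).homogeneous true hxn hyn hne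
  · rcases le_total k n with h | h
    · exact (hmono h).trans Set.subset_union_left
    · exact ((hf h).1 t).2

theorem exists_le_new_chain (c : BiCondition Z)
    (hc : ∀ c', c ≤ c' → ∃ x ∈ c'.res, {z ∈ c'.res | codedRel Z x z}.Infinite) (k : ℕ) :
    ∃ c', c ≤ c' ∧ ∃ x ∈ c'.F true, k ≤ x := by
  obtain ⟨c₁, h₁, -, hk⟩ := c.exists_le_above ∅ (by simpa using c.infinite_res) k
  obtain ⟨x, hx, hinf⟩ := hc c₁ h₁
  obtain ⟨c₂, h₂, hF, -⟩ := c₁.exists_le_chain {x} (by simpa using hx) (by simp)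
    (by simpa using hinf) 0
  exact ⟨c₂, h₁.trans h₂, x, by simp [hF], (hk x hx).1⟩

theorem exists_le_new_antichain (hω : IsOmegaOrdered Z) (c : BiCondition Z)
    (hc : ∀ c', c ≤ c' → ∃ x ∈ c'.res, {z ∈ c'.res | ¬ codedRel Z x z}.Infinite) (k : ℕ) :
    ∃ c', c ≤ c' ∧ ∃ x ∈ c'.F false, k ≤ x := by
  obtain ⟨c₁, h₁, -, hk⟩ := c.exists_le_above ∅ (by simpa using c.infinite_res) k
  obtain ⟨x, hx, hinf⟩ := hc c₁ h₁
  obtain ⟨c₂, h₂, hF, -⟩ := c₁.exists_le_antichain hω {x} (by simpa using hx) (by simp)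
    (by simpa using hinf) 0
  exact ⟨c₂, h₁.trans h₂, x, by simp [hF], (hk x hx).1⟩

theorem Compatible.subset_carrier {c : BiCondition Z} {t : Bool} {H : Set ℕ}
    (h : c.Compatible t H) : H ⊆ codedCarrier Z :=
  h.subset_union.trans (Set.union_subset (c.subset_carrier t) fun _ hx => hx.1)

/-- If `s` is generic, then an infinite `ω`-ordered poset computed from `s` has an infinite chain or
antichain that computes, together with `s`, no infinite chain or antichain of `s`. -/
theorem exists_solution (s : ℕ → ℕ → Prop) (hZ : IsNatPoset (codedCarrier Z) (codedRel Z))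
    (hω : IsOmegaOrdered Z) (hinf : (codedCarrier Z).Infinite) {d : OracleCode}
    (hd : d.Decides (relCode Set.univ s) Z)
    (hgen : ∀ e₀ e₁ F₀ F₁ A bd b₀ b₁, (∃ w v, OutputsPair d e₀ e₁ F₀ F₁ A bd s w v ∧
        Excluded s b₀ w ∧ Excluded s b₁ v) ∨
      ∃ n, ∀ w ≥ n, ∀ v ≥ n, w ≠ v → ¬ LocallyHolds s fun s' =>
        OutputsPair d e₀ e₁ F₀ F₁ A bd s' w v) :
    ∃ t, ∃ H ⊆ codedCarrier Z, H.Infinite ∧ HomogeneousAs (codedRel Z) t H ∧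
      ∀ e b, ¬ OracleCode.ComputesHomogeneous e (effectiveJoin (relCode Set.univ s) H) s b := by
  let c₀ : BiCondition Z := ⟨fun _ => ∅, ∅, 0, by simp, by rintro (_ | _) <;> simp [HomogeneousAs],
    by simp, by simp, by simpa [reservoir] using hinf⟩
  -- Both limit sets must be infinite for the two-sided argument. If below some condition one side
  -- can no longer grow, this persists in all extensions, and the other side is built alone with
  -- every requirement met.
  by_cases hA : ∃ c : BiCondition Z, ∀ x ∈ c.res, {z ∈ c.res | codedRel Z x z}.Finite
  · obtain ⟨c, hc⟩ := hA
    have hc' : ∀ c', c ≤ c' → ∀ x ∈ c'.res, {z ∈ c'.res | codedRel Z x z}.Finite :=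
      fun c' h x hx => (hc x (h.2 hx)).subset fun z hz => ⟨h.2 hz.1, hz.2⟩
    obtain ⟨f, hf, -, hfD⟩ := exists_monotone_meeting c
      (Sum.elim (fun i : OracleCode × Bool => fun c => c.Forces s false i.1 i.2)
        (fun k c => ∃ x ∈ c.F false, k ≤ x)) (by
      rintro (⟨e, b⟩ | k) p hp
      · exact exists_forces_antichain hω hd p (hc' p hp) e b (hgen _ _ _ _ _ _ _ _)
      · refine exists_le_new_antichain hω p (fun c' h => ?_) k
        obtain ⟨x, hx⟩ := c'.infinite.nonempty
        refine ⟨x, hx, ?_⟩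
        simpa using infinite_forall c'.infinite_res {x} (fun g z => ¬ codedRel Z g z)
          (by simpa using hc' c' (hp.trans h) x hx))
    have hH := compatible_iUnion hf fun k => hfD (.inr k)
    refine ⟨false, _, (hH 0).subset_carrier, (hH 0).infinite, (hH 0).homogeneous, fun e b => ?_⟩
    obtain ⟨n, hn⟩ := hfD (.inl (e, b))
    exact hn _ (hH n)
  by_cases hB : ∃ c : BiCondition Z, ∀ x ∈ c.res, {z ∈ c.res | ¬ codedRel Z x z}.Finite
  · obtain ⟨c, hc⟩ := hB
    have hc' : ∀ c', c ≤ c' → ∀ x ∈ c'.res, {z ∈ c'.res | ¬ codedRel Z x z}.Finite :=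
      fun c' h x hx => (hc x (h.2 hx)).subset fun z hz => ⟨h.2 hz.1, hz.2⟩
    obtain ⟨f, hf, -, hfD⟩ := exists_monotone_meeting c
      (Sum.elim (fun i : OracleCode × Bool => fun c => c.Forces s true i.1 i.2)
        (fun k c => ∃ x ∈ c.F true, k ≤ x)) (by
      rintro (⟨e, b⟩ | k) p hp
      · exact exists_forces_chain hd p (hc' p hp) e b (hgen _ _ _ _ _ _ _ _)
      · refine exists_le_new_chain p (fun c' h => ?_) k
        obtain ⟨x, hx⟩ := c'.infinite.nonempty
        refine ⟨x, hx, ?_⟩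
        simpa using infinite_forall c'.infinite_res {x} (codedRel Z)
          (by simpa using hc' c' (hp.trans h) x hx))
    have hH := compatible_iUnion hf fun k => hfD (.inr k)
    refine ⟨true, _, (hH 0).subset_carrier, (hH 0).infinite, (hH 0).homogeneous, fun e b => ?_⟩
    obtain ⟨n, hn⟩ := hfD (.inl (e, b))
    exact hn _ (hH n)
  push Not at hA hB
  obtain ⟨f, hf, -, hfD⟩ := exists_monotone_meeting c₀
    (Sum.elim (fun i : (OracleCode × Bool) × OracleCode × Bool => fun c =>
        c.Forces s true i.1.1 i.1.2 ∨ c.Forces s false i.2.1 i.2.2)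
      (fun (k : Bool × ℕ) c => ∃ x ∈ c.F k.1, k.2 ≤ x)) (by
    rintro (⟨⟨e₀, b₀⟩, e₁, b₁⟩ | ⟨_ | _, k⟩) p -
    · exact exists_forces hZ hω hd p e₀ e₁ b₀ b₁ (hgen _ _ _ _ _ _ _ _)
    · exact exists_le_new_antichain hω p (fun c' _ => hB c') k
    · exact exists_le_new_chain p (fun c' _ => hA c') k)
  have hH := fun t => compatible_iUnion hf fun k => hfD (.inr (t, k))
  -- If both limit sets computed homogeneous sets, the pair of their codes and types would be a
  -- requirement met by the sequence, which rules out one of the two.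
  by_contra hno
  push Not at hno
  obtain ⟨e₀, b₀, h₀⟩ := hno true _ (hH true 0).subset_carrier (hH true 0).infinite
    (hH true 0).homogeneous
  obtain ⟨e₁, b₁, h₁⟩ := hno false _ (hH false 0).subset_carrier (hH false 0).infinite
    (hH false 0).homogeneous
  obtain ⟨n, hn | hn⟩ := hfD (.inl ((e₀, b₀), e₁, b₁))
  · exact hn _ (hH true n) h₀
  · exact hn _ (hH false n) h₁

end BiCondition

/-! ### Failure of the reduction. -/

theorem mainTheorem4 : ¬ CAC.ComputablyReducible omegaCAC := by
  intro hred
  -- The index includes the code `d` and all finite data of a condition, so one countable family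
  -- serves every `Z` computable from `s`.
  obtain ⟨s, hs, hgen⟩ := exists_generic_poset
    (ι := OracleCode × OracleCode × OracleCode × Finset ℕ × Finset ℕ × Finset ℕ × ℕ)
    fun i => OutputsPair i.1 i.2.1 i.2.2.1 i.2.2.2.1 i.2.2.2.2.1 i.2.2.2.2.2.1 i.2.2.2.2.2.2
  have hcar := codedCarrier_relCode Set.univ s
  have hrel := codedRel_relCode Set.univ s
  obtain ⟨Z, ⟨⟨hZ, hinf⟩, hω⟩, hZX, hsol⟩ := hred (relCode Set.univ s) (by
    change IsNatPoset _ _ ∧ _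
    rw [hcar, hrel]
    exact ⟨hs, Set.infinite_univ⟩)
  obtain ⟨d, hd⟩ := hZX.exists_code
  obtain ⟨t, H, hHZ, hHinf, hH, hno⟩ := BiCondition.exists_solution s hZ hω hinf hd
    fun e₀ e₁ F₀ F₁ A bd b₀ b₁ => hgen (d, e₀, e₁, F₀, F₁, A, bd) b₀ b₁
  obtain ⟨W, ⟨-, hWinf, hW⟩, hWT⟩ := hsol H ⟨hHZ, hHinf, by
    cases t
    · exact .inr hH
    · exact .inl hH⟩
  obtain ⟨e, he, huse⟩ := hWT.exists_code
  rw [hrel] at hW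
  have hout : ∀ k ∈ W, ∃ m, e.OutputsBelow (effectiveJoin (relCode Set.univ s) H) k m := by
    intro k hk
    obtain ⟨m, hm⟩ := huse k
    exact ⟨m, fun A' hA' => (hm A' hA').2 hk⟩
  rcases hW with hW | hW
  · exact hno e true ⟨he ▸ hWinf, he ▸ hW, he ▸ hout⟩
  · exact hno e false ⟨he ▸ hWinf, he ▸ hW, he ▸ hout⟩
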